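/- Let $p\in\mathbb{C}[z]$ be a polynomial of degree $d\ge 2$ all of whose zeros are simple, and let $$Z_p=\{(x,y,z)\in\mathbb{C}^3 : xy=p(z)\}$$ be the corresponding smooth Danielewski surface. Consider the polynomial vector fields $$V=p'(z)\frac{\partial}{\partial x}+y\frac{\partial}{\partial z},\qquad W=p'(z)\frac{\partial}{\partial y}+x\frac{\partial}{\partial z}.$$ Then $V,\ W,\ yV,\ xW$ are locally nilpotent derivations of $\mathbb{C}[x,y,z]$ that annihilate $xy-p(z)$, and each of them has a unique flow on $Z_p$, defined for all times $t\in\mathbb{C}$. Moreover, the group $G$ of self-maps of $Z_p$ generated by all time-$t$ maps ($t\in\mathbb{C}$) of these four flows acts infinitely transitively on $Z_p$: it consists of algebraic automorphisms of $Z_p$, and for every $m\in\mathbb{N}$ and any two $m$-tuples $(a_1,\dots,a_m)$ and $(b_1,\dots,b_m)$ of pairwise distinct points of $Z_p$ there is $g\in G$ with $g(a_i)=b_i$ for $i=1,\dots,m$. -/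

import Mathlib

noncomputable section

namespace Danielewski

open MvPolynomial

/-- The surface `Z_p = {(x, y, z) ∈ ℂ³ : x y = p(z)}`; the coordinates of `v` are
`x = v 0`, `y = v 1`, `z = v 2`. -/
def surface (p : Polynomial ℂ) : Set (Fin 3 → ℂ) :=
  {v | v 0 * v 1 = p.eval (v 2)}

/-- The defining equation `x y - p(z)`, as an element of `ℂ[x, y, z]`. -/
def equation (p : Polynomial ℂ) : MvPolynomial (Fin 3) ℂ :=
  X 0 * X 1 - Polynomial.aeval (X 2) p

/-- Polynomial vector fields on `ℂ³`, as derivations of `ℂ[x, y, z]`. -/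
abbrev PolyVectorField : Type :=
  Derivation ℂ (MvPolynomial (Fin 3) ℂ) (MvPolynomial (Fin 3) ℂ)

/-- `V = p'(z) ∂/∂x + y ∂/∂z`. -/
def fieldV (p : Polynomial ℂ) : PolyVectorField :=
  Polynomial.aeval (X 2 : MvPolynomial (Fin 3) ℂ) p.derivative • pderiv 0
    + (X 1 : MvPolynomial (Fin 3) ℂ) • pderiv 2

/-- `W = p'(z) ∂/∂y + x ∂/∂z`. -/
def fieldW (p : Polynomial ℂ) : PolyVectorField :=
  Polynomial.aeval (X 2 : MvPolynomial (Fin 3) ℂ) p.derivative • pderiv 1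
    + (X 0 : MvPolynomial (Fin 3) ℂ) • pderiv 2

/-- The four vector fields `V`, `W`, `y V`, `x W`. -/
def generators (p : Polynomial ℂ) : Set PolyVectorField :=
  {fieldV p, fieldW p,
    (X 1 : MvPolynomial (Fin 3) ℂ) • fieldV p,
    (X 0 : MvPolynomial (Fin 3) ℂ) • fieldW p}

/-- Locally nilpotent derivations: every polynomial is killed by some iterate. -/
def IsLocallyNilpotent (D : PolyVectorField) : Prop :=
  ∀ f : MvPolynomial (Fin 3) ℂ, ∃ n : ℕ, D^[n] f = 0

/-- The vector of `D` at the point `v`. -/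
def vectorAt (D : PolyVectorField) (v : Fin 3 → ℂ) : Fin 3 → ℂ :=
  fun i => eval v (D (X i))

/-- `φ` is the (complex-time) flow of `D` on the surface: `φ₀ = id` and
`d/dt φ_t(P) = D(φ_t(P))` for all `P` and all `t ∈ ℂ`. -/
structure IsFlow (p : Polynomial ℂ) (D : PolyVectorField)
    (φ : ℂ → Equiv.Perm (surface p)) : Prop where
  map_zero : φ 0 = 1
  hasDerivAt : ∀ (P : surface p) (t : ℂ),
    HasDerivAt (fun s : ℂ => (φ s P : Fin 3 → ℂ)) (vectorAt D (φ t P)) t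

/-- The group of bijections of the surface generated by all time-`t` maps, `t ∈ ℂ`, of the flows
of `V`, `W`, `y V`, `x W`. -/
def flowGroup (p : Polynomial ℂ) : Subgroup (Equiv.Perm (surface p)) :=
  Subgroup.closure
    {g | ∃ D ∈ generators p, ∃ φ : ℂ → Equiv.Perm (surface p), IsFlow p D φ ∧ ∃ t : ℂ, g = φ t}

/-- Self-maps of the surface that are given by polynomials in the coordinates. -/
def IsPolynomialMap {p : Polynomial ℂ} (g : surface p → surface p) : Prop :=
  ∃ F : Fin 3 → MvPolynomial (Fin 3) ℂ,
    ∀ (P : surface p) (i : Fin 3), (g P : Fin 3 → ℂ) i = eval (P : Fin 3 → ℂ) (F i)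

/-- Algebraic automorphisms of the surface. -/
def IsAlgebraicAutomorphism {p : Polynomial ℂ} (g : Equiv.Perm (surface p)) : Prop :=
  IsPolynomialMap g ∧ IsPolynomialMap g.symm

/-- A group of bijections of a smooth surface `Z_p` acts infinitely transitively if it acts through
algebraic automorphisms and `m`-transitively for every `m`. -/
def ActsInfinitelyTransitively {p : Polynomial ℂ} (G : Subgroup (Equiv.Perm (surface p))) : Prop :=
  (∀ g ∈ G, IsAlgebraicAutomorphism g) ∧
    ∀ m : ℕ, MulAction.IsMultiplyPretransitive G (surface p) m

end Danielewski

end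

/-!
Write `u_0 = x`, `u_1 = y`. A multiple `q(x) W` of `W` has the explicit polynomial flow
`z ↦ z + t q(x) x` with `x` fixed and `y` determined by `x y = p(z)` (and `y ↦ y + t q(0) p'(z)` on
the line `x = 0`); the same holds for `q(y) V`. Uniqueness of the flow of a locally nilpotent `D`
follows by induction on `n` for the functions `f` with `D^n f = 0`: the difference of such an `f`
along two flows has derivative zero (`IsFlow.eq_of_isLocallyNilpotent`).

For transitivity, fix a tuple `a` of distinct points, and consider polynomial families
`ℂ^N → (ℂ^3)^m` with values in the orbit of `a`. The polynomials vanishing on a family form a prime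
ideal, and a family may be enlarged by flowing along one of the four fields for a variable time. If
the height of the ideal is minimal, the enlarged family has the same ideal `K`, so `K` is invariant
under the diagonal action of the four fields
(`exists_isOrbitFamily_generators_subset`), hence under the Lie algebra they generate.

That Lie algebra is computed with Hamiltonian functions: `V`, `W`, `y V`, `x W` correspond, up to
constants, to `y`, `x`, `y²`, `x²`, and since `{x ^ k, x ^ a f(z)} = k x ^ (a + k) f'(z)` and
`{x ^ k, y} = k x ^ (k - 1) p'(z)`, repeated brackets produce all sufficiently high powers of `x`,
and of `y` by symmetry (`hamField_one_mem`). So the zero set of `K` is invariant under the flows of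
`q(x) W` and `q(y) V` for all `q` divisible by a high power of the variable. By interpolation, such
shears move the coordinates `z` of the points independently, as long as the coordinates `x`
(respectively `y`) are distinct and nonzero, and three shears reach all prescribed `(y, z)` with
distinct nonzero `y` (`exists_mem_zeroTuples`).

Consequently no nonzero polynomial in the coordinates `(y, z)` vanishes on the family, so by
Chevalley's theorem and the Nullstellensatz the orbit of `a` covers the complement of a hypersurface
in these coordinates (`exists_ne_zero_forall_exists_mem_flowGroup`). Two such complements meet, and
where `y ≠ 0` a point of the surface is determined by `(y, z)`; hence any two orbits coincide.
-/

noncomputable section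

namespace Danielewski

open MvPolynomial

/-! ### Derivations of polynomial rings -/

section Derivations

variable {σ ι : Type*}

theorem iterate_derivation_eq_zero_of_le {D : Derivation ℂ (MvPolynomial σ ℂ) (MvPolynomial σ ℂ)}
    {f : MvPolynomial σ ℂ} {a b : ℕ} (h : D^[a] f = 0) (hab : a ≤ b) : D^[b] f = 0 := by
  obtain ⟨c, rfl⟩ := Nat.exists_eq_add_of_le hab
  rw [add_comm, Function.iterate_add_apply, h, iterate_map_zero]

theorem iterate_derivation_mul_eq_zero
    (D : Derivation ℂ (MvPolynomial σ ℂ) (MvPolynomial σ ℂ)) (n : ℕ) :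
    ∀ (a b : ℕ) (f g : MvPolynomial σ ℂ), a + b = n → D^[a] f = 0 → D^[b] g = 0 →
      D^[n] (f * g) = 0 := by
  induction n with
  | zero =>
    intro a b f g hn ha hb
    obtain rfl : a = 0 := by omega
    have hf : f = 0 := ha
    simp [hf]
  | succ n ih =>
    intro a b f g hn ha hb
    rcases a with - | a
    · have hf : f = 0 := ha
      rw [hf, zero_mul, iterate_map_zero]
    rcases b with - | b
    · have hg : g = 0 := hb
      rw [hg, mul_zero, iterate_map_zero]
    rw [Function.iterate_succ_apply, D.leibniz, iterate_map_add, smul_eq_mul, smul_eq_mul,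
      ih (a + 1) b f (D g) (by omega) ha hb, mul_comm g,
      ih a (b + 1) (D f) g (by omega) ha hb, add_zero]

/-- The subalgebra of the elements killed by some iterate of a derivation. -/
def nilpotentPart (D : Derivation ℂ (MvPolynomial σ ℂ) (MvPolynomial σ ℂ)) :
    Subalgebra ℂ (MvPolynomial σ ℂ) where
  carrier := {f | ∃ n : ℕ, D^[n] f = 0}
  algebraMap_mem' a := ⟨1, D.map_algebraMap a⟩
  add_mem' {f g} hf hg := by
    obtain ⟨a, ha⟩ := hf
    obtain ⟨b, hb⟩ := hg
    exact ⟨max a b, by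
      rw [iterate_map_add, iterate_derivation_eq_zero_of_le ha (le_max_left a b),
        iterate_derivation_eq_zero_of_le hb (le_max_right a b), add_zero]⟩
  mul_mem' {f g} hf hg := by
    obtain ⟨a, ha⟩ := hf
    obtain ⟨b, hb⟩ := hg
    exact ⟨a + b, iterate_derivation_mul_eq_zero D _ a b _ _ rfl ha hb⟩

theorem mem_nilpotentPart_of_apply_mem {D : Derivation ℂ (MvPolynomial σ ℂ) (MvPolynomial σ ℂ)}
    {f : MvPolynomial σ ℂ} (h : D f ∈ nilpotentPart D) : f ∈ nilpotentPart D := by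
  obtain ⟨n, hn⟩ := h
  exact ⟨n + 1, hn⟩

theorem mem_nilpotentPart_of_X_mem {D : Derivation ℂ (MvPolynomial σ ℂ) (MvPolynomial σ ℂ)}
    (h : ∀ i, X i ∈ nilpotentPart D) (f : MvPolynomial σ ℂ) : f ∈ nilpotentPart D := by
  have : Algebra.adjoin ℂ (Set.range (X : σ → MvPolynomial σ ℂ)) ≤ nilpotentPart D :=
    Algebra.adjoin_le (by rintro _ ⟨i, rfl⟩; exact h i)
  rw [adjoin_range_X] at this
  exact this trivial

/-- A derivation of `ℂ[x, y, z]` acting simultaneously on all points of a tuple indexed by `ι`: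
the variable `(k, c)` is the `c`-th coordinate of the `k`-th point. -/
def diagonal (ι : Type*) (D : PolyVectorField) :
    Derivation ℂ (MvPolynomial (ι × Fin 3) ℂ) (MvPolynomial (ι × Fin 3) ℂ) :=
  mkDerivation ℂ fun n => rename (Prod.mk n.1) (D (X n.2))

theorem diagonal_X (D : PolyVectorField) (n : ι × Fin 3) :
    diagonal ι D (X n) = rename (Prod.mk n.1) (D (X n.2)) :=
  mkDerivation_X _ _ _

theorem diagonal_rename (D : PolyVectorField) (k : ι) (f : MvPolynomial (Fin 3) ℂ) :
    diagonal ι D (rename (Prod.mk k) f) = rename (Prod.mk k) (D f) := by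
  induction f using MvPolynomial.induction_on with
  | C a => simp
  | add f g hf hg => simp [hf, hg]
  | mul_X f i hf => simp [hf, diagonal_X]

theorem diagonal_iterate_rename (D : PolyVectorField) (k : ι) (n : ℕ)
    (f : MvPolynomial (Fin 3) ℂ) :
    (diagonal ι D)^[n] (rename (Prod.mk k) f) = rename (Prod.mk k) (D^[n] f) := by
  induction n generalizing f with
  | zero => rfl
  | succ n ih => rw [Function.iterate_succ_apply, Function.iterate_succ_apply, diagonal_rename, ih]

theorem exists_iterate_diagonal_eq_zero {D : PolyVectorField} (hD : IsLocallyNilpotent D)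
    (f : MvPolynomial (ι × Fin 3) ℂ) : ∃ n : ℕ, (diagonal ι D)^[n] f = 0 := by
  refine mem_nilpotentPart_of_X_mem (fun ⟨k, c⟩ => ?_) f
  obtain ⟨n, hn⟩ := hD (X c)
  refine ⟨n, ?_⟩
  have := diagonal_iterate_rename D k n (X c)
  rwa [rename_X, hn, map_zero] at this

/-- The vector fields whose diagonal action preserves an ideal form a Lie subalgebra. -/
def idealStabilizer (K : Ideal (MvPolynomial (ι × Fin 3) ℂ)) : LieSubalgebra ℂ PolyVectorField where
  carrier := {D | ∀ f ∈ K, diagonal ι D f ∈ K}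
  zero_mem' f _ := by
    have : diagonal ι (0 : PolyVectorField) = 0 := derivation_ext fun n => by simp [diagonal_X]
    simp [this]
  add_mem' {D E} hD hE f hf := by
    have : diagonal ι (D + E) = diagonal ι D + diagonal ι E :=
      derivation_ext fun n => by simp [diagonal_X]
    rw [this]
    exact K.add_mem (hD f hf) (hE f hf)
  smul_mem' c D hD f hf := by
    have : diagonal ι (c • D) = c • diagonal ι D :=
      derivation_ext fun n => by simp [diagonal_X]
    rw [this, Derivation.smul_apply, smul_eq_C_mul]
    exact K.mul_mem_left _ (hD f hf)
  lie_mem' {D E} hD hE f hf := by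
    have : diagonal ι ⁅D, E⁆ = ⁅diagonal ι D, diagonal ι E⁆ :=
      derivation_ext fun n => by
        simp [diagonal_X, Derivation.commutator_apply, diagonal_rename]
    rw [this, Derivation.commutator_apply]
    exact K.sub_mem (hD _ (hE f hf)) (hE _ (hD f hf))

end Derivations

/-! ### The Lie algebra generated by the four fields -/

/-- The two orders `(x, y)` and `(y, x)` of the first two coordinates, which are called `u_i` and
`u_j` in comments below. The fields `V` and `W`, and
everything derived from them, are exchanged by the symmetry `x ↔ y`. -/
def IsPair (i j : Fin 3) : Prop := i = 0 ∧ j = 1 ∨ i = 1 ∧ j = 0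

theorem IsPair.symm {i j : Fin 3} (h : IsPair i j) : IsPair j i := by
  rcases h with ⟨rfl, rfl⟩ | ⟨rfl, rfl⟩
  exacts [.inr ⟨rfl, rfl⟩, .inl ⟨rfl, rfl⟩]

/-- The field `p'(z) ∂/∂u_j + u_i ∂/∂z`: this is `W` for `(i, j) = (0, 1)` and `V` for
`(i, j) = (1, 0)`. -/
def shearField (p : Polynomial ℂ) (i j : Fin 3) : PolyVectorField :=
  Polynomial.aeval (X 2 : MvPolynomial (Fin 3) ℂ) p.derivative • pderiv j
    + (X i : MvPolynomial (Fin 3) ℂ) • pderiv 2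

/-- The Hamiltonian field of `u_i ^ a * f(z)` for the Poisson bracket with `{z, x} = -x`,
`{z, y} = y`, `{x, y} = p'(z)` (and its mirror image if `(i, j) = (1, 0)`), for which `x y - p(z)`
is a Casimir function. -/
def hamField (p : Polynomial ℂ) (i j : Fin 3) (a : ℕ) (f : Polynomial ℂ) : PolyVectorField :=
  mkDerivation ℂ fun n =>
    if n = i then -(X i ^ (a + 1) * Polynomial.aeval (X 2) f.derivative)
    else if n = j then
      (a : MvPolynomial (Fin 3) ℂ) * X i ^ (a - 1) * Polynomial.aeval (X 2) f
          * Polynomial.aeval (X 2) p.derivative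
        + X i ^ a * X j * Polynomial.aeval (X 2) f.derivative
    else (a : MvPolynomial (Fin 3) ℂ) * X i ^ a * Polynomial.aeval (X 2) f

theorem derivation_aeval (D : PolyVectorField) (u : MvPolynomial (Fin 3) ℂ) (f : Polynomial ℂ) :
    D (Polynomial.aeval u f) = Polynomial.aeval u f.derivative * D u := by
  induction f using Polynomial.induction_on' with
  | add f g hf hg => simp [hf, hg, add_mul]
  | monomial n a =>
    rw [Polynomial.aeval_monomial, Polynomial.derivative_monomial, Polynomial.aeval_monomial,
      D.leibniz, D.leibniz_pow]
    simp
    ring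

section Brackets

variable {p : Polynomial ℂ} {i j : Fin 3}

theorem hamField_one (hij : IsPair i j) (k : ℕ) :
    hamField p i j k 1 = (k : ℂ) • (X i : MvPolynomial (Fin 3) ℂ) ^ (k - 1) • shearField p i j := by
  refine derivation_ext fun n => ?_
  rcases k with - | k
  · rcases hij with ⟨rfl, rfl⟩ | ⟨rfl, rfl⟩ <;> fin_cases n <;>
      simp [hamField, shearField, mkDerivation_X]
  rcases hij with ⟨rfl, rfl⟩ | ⟨rfl, rfl⟩ <;> fin_cases n <;>
    simp [hamField, shearField, mkDerivation_X, pderiv_X, smul_eq_C_mul,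
      -mul_eq_mul_left_iff] <;> ring

set_option linter.unusedSimpArgs false in
theorem lie_hamField_one_hamField (hij : IsPair i j) (k a : ℕ) (f : Polynomial ℂ) :
    ⁅hamField p i j k 1, hamField p i j a f⁆ = (k : ℂ) • hamField p i j (a + k) f.derivative := by
  refine derivation_ext fun n => ?_
  rcases k with - | - | k <;> rcases a with - | a <;>
  rcases hij with ⟨rfl, rfl⟩ | ⟨rfl, rfl⟩ <;> fin_cases n <;>
    simp [hamField, mkDerivation_X, Derivation.commutator_apply, derivation_aeval,
      Derivation.leibniz_pow, smul_eq_C_mul, -mul_eq_mul_left_iff] <;> ring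

set_option linter.unusedSimpArgs false in
theorem lie_hamField_one_shearField (hij : IsPair i j) (k : ℕ) :
    ⁅hamField p i j k 1, shearField p j i⁆ = (-k : ℂ) • hamField p i j (k - 1) p.derivative := by
  refine derivation_ext fun n => ?_
  rcases k with - | k
  · rcases hij with ⟨rfl, rfl⟩ | ⟨rfl, rfl⟩ <;> fin_cases n <;>
    simp [hamField, shearField, mkDerivation_X, Derivation.commutator_apply, derivation_aeval,
      Derivation.leibniz_pow, smul_eq_C_mul, pderiv_X, Pi.single_apply]
  rcases k with - | k <;>
  rcases hij with ⟨rfl, rfl⟩ | ⟨rfl, rfl⟩ <;> fin_cases n <;>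
    simp [hamField, shearField, mkDerivation_X, Derivation.commutator_apply, derivation_aeval,
      Derivation.leibniz_pow, smul_eq_C_mul, pderiv_X, Pi.single_apply] <;> ring

theorem hamField_C (a : ℕ) (c : ℂ) :
    hamField p i j a (Polynomial.C c) = c • hamField p i j a 1 := by
  refine derivation_ext fun n => ?_
  simp only [hamField, mkDerivation_X, Derivation.smul_apply, smul_eq_C_mul,
    Polynomial.derivative_C, Polynomial.derivative_one, map_zero, map_one, Polynomial.aeval_C,
    algebraMap_eq]
  split_ifs <;> ring

/-- In terms of Hamiltonian functions: bracket `n` times with `u_i` or `u_i²`, the latter `s`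
times. -/
theorem hamField_iterate_derivative_mem (hij : IsPair i j) {L : LieSubalgebra ℂ PolyVectorField}
    (h₁ : hamField p i j 1 1 ∈ L) (h₂ : hamField p i j 2 1 ∈ L) {a : ℕ} {f : Polynomial ℂ}
    (hf : hamField p i j a f ∈ L) (n : ℕ) :
    ∀ s ≤ n, hamField p i j (a + n + s) (Polynomial.derivative^[n] f) ∈ L := by
  have step {k b : ℕ} (hk : k ≠ 0) {g : Polynomial ℂ} (h : hamField p i j k 1 ∈ L)
      (hg : hamField p i j b g ∈ L) : hamField p i j (b + k) (Polynomial.derivative g) ∈ L := by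
    have := L.lie_mem h hg
    rw [lie_hamField_one_hamField hij] at this
    have := L.smul_mem ((k : ℂ)⁻¹) this
    rwa [inv_smul_smul₀ (Nat.cast_ne_zero.2 hk)] at this
  induction n with
  | zero =>
    intro s hs
    obtain rfl : s = 0 := by omega
    exact hf
  | succ n ih =>
    intro s hs
    rw [Function.iterate_succ_apply']
    rcases hs.eq_or_lt with rfl | hs
    · have := step two_ne_zero h₂ (ih n le_rfl)
      rwa [show a + n + n + 2 = a + (n + 1) + (n + 1) by omega] at this
    · have := step one_ne_zero h₁ (ih s (by omega))
      rwa [show a + n + s + 1 = a + (n + 1) + s by omega] at this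

/-- In terms of Hamiltonian functions and up to constant factors: bracketing `u_i ^ k` with `u_j`
gives `u_i ^ (k - 1) * p'(z)`,
and differentiating `d - 1` more times in `z` removes the dependence on `z`. -/
theorem hamField_one_mem_of_mem (hij : IsPair i j) (hp : p.natDegree ≠ 0)
    {L : LieSubalgebra ℂ PolyVectorField}
    (h₁ : hamField p i j 1 1 ∈ L) (h₂ : hamField p i j 2 1 ∈ L) (h₃ : shearField p j i ∈ L)
    {k : ℕ} (hk : k ≠ 0) (h : hamField p i j k 1 ∈ L) {s : ℕ} (hs : s ≤ p.natDegree - 1) :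
    hamField p i j (k - 1 + (p.natDegree - 1) + s) 1 ∈ L := by
  have hk' : (-k : ℂ) ≠ 0 := neg_ne_zero.2 (Nat.cast_ne_zero.2 hk)
  have := L.lie_mem h h₃
  rw [lie_hamField_one_shearField hij] at this
  have := L.smul_mem ((-k : ℂ)⁻¹) this
  rw [inv_smul_smul₀ hk'] at this
  have := hamField_iterate_derivative_mem hij h₁ h₂ this (p.natDegree - 1) s hs
  rw [← Function.iterate_succ_apply, show (p.natDegree - 1).succ = p.natDegree by omega,
    ← Polynomial.factorial_smul_hasseDeriv, LinearMap.smul_apply,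
    Polynomial.hasseDeriv_natDegree_eq_C, nsmul_eq_mul, ← Polynomial.C_eq_natCast,
    ← Polynomial.C_mul, hamField_C] at this
  have hc : ((p.natDegree.factorial : ℕ) : ℂ) * p.leadingCoeff ≠ 0 :=
    mul_ne_zero (Nat.cast_ne_zero.2 p.natDegree.factorial_ne_zero) <|
      Polynomial.leadingCoeff_ne_zero.2 (by rintro rfl; simp at hp)
  have := L.smul_mem (((p.natDegree.factorial : ℕ) : ℂ) * p.leadingCoeff)⁻¹ this
  rwa [inv_smul_smul₀ hc] at this

/-- A Lie algebra containing the Hamiltonian fields of `u_i`, `u_i²` and `u_j` contains those of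
all `u_i ^ e` with `e ≥ d - 1`; the exponents up to `2 (d - 1)` come from `k = 1` in the previous
lemma, and then `k` leads to `k + d - 1`. -/
theorem hamField_one_mem (hij : IsPair i j) (hp : 2 ≤ p.natDegree)
    {L : LieSubalgebra ℂ PolyVectorField}
    (h₁ : hamField p i j 1 1 ∈ L) (h₂ : hamField p i j 2 1 ∈ L) (h₃ : shearField p j i ∈ L)
    (e : ℕ) (he : p.natDegree - 1 ≤ e) : hamField p i j e 1 ∈ L := by
  induction e using Nat.strong_induction_on with
  | _ e ih =>
    have hp' : p.natDegree ≠ 0 := by omega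
    by_cases h : e ≤ 2 * (p.natDegree - 1)
    · have := hamField_one_mem_of_mem hij hp' h₁ h₂ h₃ one_ne_zero h₁
        (s := e - (p.natDegree - 1)) (by omega)
      rwa [show 1 - 1 + (p.natDegree - 1) + (e - (p.natDegree - 1)) = e by omega] at this
    · have := hamField_one_mem_of_mem hij hp' h₁ h₂ h₃ (by omega)
        (ih (e - (p.natDegree - 1)) (by omega) (by omega)) (s := 1) (by omega)
      rwa [show e - (p.natDegree - 1) - 1 + (p.natDegree - 1) + 1 = e by omega] at this

/-- A Lie algebra containing `V`, `W` and `x W` contains `x ^ d * r(x) * W` for every polynomial `r`,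
and likewise with `x` and `y` exchanged. -/
theorem aeval_smul_shearField_mem (hij : IsPair i j) (hp : 2 ≤ p.natDegree)
    {L : LieSubalgebra ℂ PolyVectorField}
    (h₁ : shearField p i j ∈ L) (h₂ : (X i : MvPolynomial (Fin 3) ℂ) • shearField p i j ∈ L)
    (h₃ : shearField p j i ∈ L) (r : Polynomial ℂ) :
    Polynomial.aeval (X i : MvPolynomial (Fin 3) ℂ) (Polynomial.X ^ p.natDegree * r) •
      shearField p i j ∈ L := by
  have key (e : ℕ) (he : p.natDegree ≤ e) :
      (X i : MvPolynomial (Fin 3) ℂ) ^ e • shearField p i j ∈ L := by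
    have := hamField_one_mem hij hp (L := L) (by simpa [hamField_one hij] using h₁)
      (by simpa [hamField_one hij] using L.smul_mem 2 h₂) h₃ (e + 1) (by omega)
    rw [hamField_one hij] at this
    have := L.smul_mem (((e + 1 : ℕ) : ℂ)⁻¹) this
    rwa [inv_smul_smul₀ (Nat.cast_ne_zero.2 (by omega))] at this
  induction r using Polynomial.induction_on' with
  | add f g hf hg =>
    rw [mul_add, map_add, add_smul]
    exact L.add_mem hf hg
  | monomial n a =>
    have := L.smul_mem a (key (p.natDegree + n) (by omega))
    convert this using 1
    refine derivation_ext fun n => ?_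
    simp [Polynomial.aeval_monomial, smul_eq_C_mul, pow_add]
    ring

theorem aeval_smul_shearField_isLocallyNilpotent (hij : IsPair i j) (q : Polynomial ℂ) :
    IsLocallyNilpotent
      (Polynomial.aeval (X i : MvPolynomial (Fin 3) ℂ) q • shearField p i j) := by
  set D := Polynomial.aeval (X i : MvPolynomial (Fin 3) ℂ) q • shearField p i j with hD
  have aeval_mem {u : MvPolynomial (Fin 3) ℂ} (hu : u ∈ nilpotentPart D) (f : Polynomial ℂ) :
      Polynomial.aeval u f ∈ nilpotentPart D :=
    Algebra.adjoin_le (Set.singleton_subset_iff.2 hu) (Polynomial.aeval_mem_adjoin_singleton ℂ u)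
  have hi : X i ∈ nilpotentPart D := by
    refine ⟨1, ?_⟩
    rcases hij with ⟨rfl, rfl⟩ | ⟨rfl, rfl⟩ <;> simp [hD, shearField, pderiv_X]
  have h2 : X 2 ∈ nilpotentPart D := by
    apply mem_nilpotentPart_of_apply_mem
    have : D (X 2) = Polynomial.aeval (X i : MvPolynomial (Fin 3) ℂ) q * X i := by
      rcases hij with ⟨rfl, rfl⟩ | ⟨rfl, rfl⟩ <;> simp [hD, shearField, pderiv_X]
    rw [this]
    exact mul_mem (aeval_mem hi q) hi
  have hj : X j ∈ nilpotentPart D := by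
    apply mem_nilpotentPart_of_apply_mem
    have : D (X j) = Polynomial.aeval (X i : MvPolynomial (Fin 3) ℂ) q *
        Polynomial.aeval (X 2 : MvPolynomial (Fin 3) ℂ) p.derivative := by
      rcases hij with ⟨rfl, rfl⟩ | ⟨rfl, rfl⟩ <;> simp [hD, shearField, pderiv_X]
    rw [this]
    exact mul_mem (aeval_mem hi q) (aeval_mem h2 _)
  refine mem_nilpotentPart_of_X_mem fun n => ?_
  rcases hij with ⟨rfl, rfl⟩ | ⟨rfl, rfl⟩ <;> fin_cases n <;> assumption

theorem aeval_smul_shearField_equation (hij : IsPair i j) (q : Polynomial ℂ) :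
    (Polynomial.aeval (X i : MvPolynomial (Fin 3) ℂ) q • shearField p i j) (equation p) = 0 := by
  rcases hij with ⟨rfl, rfl⟩ | ⟨rfl, rfl⟩ <;>
    simp [equation, shearField, pderiv_X] <;> ring

end Brackets

/-! ### Shears of the surface and their flows -/

section Shear

variable {A B : Type*} [CommRing A] [Algebra ℂ A] [CommRing B] [Algebra ℂ B]

/-- The difference quotient `(p(z + w) - p(z)) / w`, as a polynomial expression in `z` and `w`. -/
def diffQuot (p : Polynomial ℂ) (z w : A) : A :=
  ∑ k ∈ Finset.range p.natDegree, Polynomial.aeval z (Polynomial.hasseDeriv (k + 1) p) * w ^ k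

theorem eval_add_eq_diffQuot (p : Polynomial ℂ) (z w : ℂ) :
    p.eval (z + w) = p.eval z + w * diffQuot p z w := by
  rw [add_comm z w, ← Polynomial.taylor_eval, Polynomial.eval_eq_sum_range,
    Polynomial.natDegree_taylor, Finset.sum_range_succ', diffQuot, Finset.mul_sum, add_comm]
  simp only [Polynomial.taylor_coeff, Polynomial.coe_aeval_eq_eval]
  simp only [Polynomial.hasseDeriv_zero', pow_zero, mul_one]
  congr 1
  exact Finset.sum_congr rfl fun k _ => by ring

theorem diffQuot_zero_right (p : Polynomial ℂ) (z : ℂ) :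
    diffQuot p z 0 = p.derivative.eval z := by
  rcases h : p.natDegree with - | n
  · rw [diffQuot, h, Polynomial.eq_C_of_natDegree_eq_zero h]
    simp
  · rw [diffQuot, h, Finset.sum_range_succ']
    simp

/-- The shear with parameter `c`: it fixes the coordinate `u_i`, adds `c * u_i` to `z`, and changes
`u_j` so that `u_i * u_j - p(z)` is preserved. The coordinates are taken in any algebra, so that
families of points may be sheared. -/
def shearMap (p : Polynomial ℂ) (i j : Fin 3) (c : A) (v : Fin 3 → A) : Fin 3 → A := fun n =>
  if n = 2 then v 2 + c * v i
  else if n = j then v j + c * diffQuot p (v 2) (c * v i)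
  else v n

theorem map_shearMap (φ : A →ₐ[ℂ] B) (p : Polynomial ℂ) (i j : Fin 3) (c : A) (v : Fin 3 → A)
    (n : Fin 3) : φ (shearMap p i j c v n) = shearMap p i j (φ c) (fun k => φ (v k)) n := by
  simp only [shearMap, diffQuot]
  split_ifs <;> simp [map_sum, Polynomial.aeval_algHom_apply]

theorem eval_shearMap {σ : Type*} (u : σ → ℂ) (p : Polynomial ℂ) (i j : Fin 3)
    (c : MvPolynomial σ ℂ) (v : Fin 3 → MvPolynomial σ ℂ) (n : Fin 3) :
    eval u (shearMap p i j c v n) = shearMap p i j (eval u c) (fun k => eval u (v k)) n := by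
  have := map_shearMap (aeval u) p i j c v n
  simpa only [aeval_eq_eval] using this

theorem eval_aeval_X (v : Fin 3 → ℂ) (n : Fin 3) (f : Polynomial ℂ) :
    eval v (Polynomial.aeval (X n : MvPolynomial (Fin 3) ℂ) f) = f.eval (v n) := by
  have := Polynomial.aeval_algHom_apply (aeval v) (X n : MvPolynomial (Fin 3) ℂ) f
  simpa [aeval_eq_eval] using this.symm

variable {p : Polynomial ℂ} {i j : Fin 3}

theorem IsPair.mul_eq_iff (hij : IsPair i j) {v : Fin 3 → ℂ} :
    v ∈ surface p ↔ v i * v j = p.eval (v 2) := by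
  rcases hij with ⟨rfl, rfl⟩ | ⟨rfl, rfl⟩
  · rfl
  · rw [mul_comm]; rfl

theorem IsPair.ext {A : Type*} (hij : IsPair i j) {v w : Fin 3 → A} (hi : v i = w i) (hj : v j = w j)
    (h2 : v 2 = w 2) : v = w := by
  funext n
  rcases hij with ⟨rfl, rfl⟩ | ⟨rfl, rfl⟩ <;> fin_cases n <;> assumption

theorem shearMap_left (hij : IsPair i j) (c : A) (v : Fin 3 → A) :
    shearMap p i j c v i = v i := by
  rcases hij with ⟨rfl, rfl⟩ | ⟨rfl, rfl⟩ <;> rfl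

theorem shearMap_right (hij : IsPair i j) (c : A) (v : Fin 3 → A) :
    shearMap p i j c v j = v j + c * diffQuot p (v 2) (c * v i) := by
  rcases hij with ⟨rfl, rfl⟩ | ⟨rfl, rfl⟩ <;> rfl

theorem shearMap_two (c : A) (v : Fin 3 → A) : shearMap p i j c v 2 = v 2 + c * v i := rfl

theorem shearMap_mem_surface (hij : IsPair i j) (c : ℂ) {v : Fin 3 → ℂ} (hv : v ∈ surface p) :
    shearMap p i j c v ∈ surface p := by
  rw [hij.mul_eq_iff] at hv ⊢
  rw [shearMap_left hij, shearMap_right hij, shearMap_two, eval_add_eq_diffQuot, ← hv]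
  ring

theorem shearMap_shearMap (hij : IsPair i j) (c c' : ℂ) {v : Fin 3 → ℂ} (hv : v ∈ surface p) :
    shearMap p i j c' (shearMap p i j c v) = shearMap p i j (c + c') v := by
  have h2 : shearMap p i j c' (shearMap p i j c v) 2 = shearMap p i j (c + c') v 2 := by
    simp only [shearMap_two, shearMap_left hij]
    ring
  refine hij.ext (by simp only [shearMap_left hij]) ?_ h2
  by_cases hi : v i = 0
  · simp only [shearMap_left hij, shearMap_right hij, shearMap_two, hi, mul_zero, add_zero]
    ring
  · have h₁ := hij.mul_eq_iff.1
      (shearMap_mem_surface hij c' (shearMap_mem_surface hij c hv))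
    have h₂ := hij.mul_eq_iff.1 (shearMap_mem_surface hij (c + c') hv)
    rw [h2, ← h₂] at h₁
    simp only [shearMap_left hij] at h₁
    exact mul_left_cancel₀ hi h₁

theorem shearMap_zero (hij : IsPair i j) (v : Fin 3 → A) : shearMap p i j 0 v = v :=
  hij.ext (shearMap_left hij 0 v) (by simp [shearMap_right hij]) (by simp [shearMap_two])

/-- The shear of the surface whose parameter is the function `q(u_i)`. -/
def shear (p : Polynomial ℂ) (hij : IsPair i j) (q : Polynomial ℂ) :
    Equiv.Perm (surface p) where
  toFun P := ⟨shearMap p i j (q.eval ((P : Fin 3 → ℂ) i)) P, shearMap_mem_surface hij _ P.2⟩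
  invFun P := ⟨shearMap p i j (-q.eval ((P : Fin 3 → ℂ) i)) P, shearMap_mem_surface hij _ P.2⟩
  left_inv P := Subtype.ext <| by
    simp only [shearMap_left hij]
    rw [shearMap_shearMap hij _ _ P.2, add_neg_cancel, shearMap_zero hij]
  right_inv P := Subtype.ext <| by
    simp only [shearMap_left hij]
    rw [shearMap_shearMap hij _ _ P.2, neg_add_cancel, shearMap_zero hij]

theorem coe_shear (hij : IsPair i j) (q : Polynomial ℂ) (P : surface p) :
    (shear p hij q P : Fin 3 → ℂ) = shearMap p i j (q.eval ((P : Fin 3 → ℂ) i)) P := rfl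

theorem shear_zero (hij : IsPair i j) : shear p hij 0 = 1 := by
  ext1 P
  apply Subtype.ext
  rw [coe_shear, Polynomial.eval_zero, shearMap_zero hij]
  rfl

theorem shear_symm (hij : IsPair i j) (q : Polynomial ℂ) :
    (shear p hij q).symm = shear p hij (-q) := by
  ext1 P
  apply Subtype.ext
  rw [coe_shear, Polynomial.eval_neg]
  rfl

theorem shear_isPolynomialMap (hij : IsPair i j) (q : Polynomial ℂ) :
    IsPolynomialMap (shear p hij q) := by
  refine ⟨shearMap p i j (Polynomial.aeval (X i) q) X, fun P n => ?_⟩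
  rw [coe_shear, eval_shearMap, eval_aeval_X]
  simp

theorem shear_isAlgebraicAutomorphism (hij : IsPair i j) (q : Polynomial ℂ) :
    IsAlgebraicAutomorphism (shear p hij q) :=
  ⟨shear_isPolynomialMap hij q, shear_symm hij q ▸ shear_isPolynomialMap hij (-q)⟩

theorem shear_isFlow (hij : IsPair i j) (q : Polynomial ℂ) :
    IsFlow p (Polynomial.aeval (X i : MvPolynomial (Fin 3) ℂ) q • shearField p i j)
      (fun t => shear p hij (Polynomial.C t * q)) := by
  refine ⟨?_, fun P t => ?_⟩
  · simp only [map_zero, zero_mul, shear_zero]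
  set v : Fin 3 → ℂ := (P : Fin 3 → ℂ) with hv
  set b : ℂ := q.eval (v i) with hb
  have hφ (s : ℂ) : (shear p hij (Polynomial.C s * q) P : Fin 3 → ℂ) =
      shearMap p i j (s * b) v := by
    rw [coe_shear]; simp [hb, hv]
  simp only [hφ]
  set D := Polynomial.aeval (X i : MvPolynomial (Fin 3) ℂ) q • shearField p i j with hD
  have hDi (w : Fin 3 → ℂ) : vectorAt D w i = 0 := by
    rcases hij with ⟨rfl, rfl⟩ | ⟨rfl, rfl⟩ <;> simp [vectorAt, hD, shearField, pderiv_X]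
  have hDj (w : Fin 3 → ℂ) : vectorAt D w j = q.eval (w i) * p.derivative.eval (w 2) := by
    rcases hij with ⟨rfl, rfl⟩ | ⟨rfl, rfl⟩ <;> simp [vectorAt, hD, shearField, pderiv_X, eval_aeval_X]
  have hD2 (w : Fin 3 → ℂ) : vectorAt D w 2 = q.eval (w i) * w i := by
    rcases hij with ⟨rfl, rfl⟩ | ⟨rfl, rfl⟩ <;> simp [vectorAt, hD, shearField, pderiv_X, eval_aeval_X]
  have h2 : HasDerivAt (fun s : ℂ => v 2 + s * b * v i) (b * v i) t := by
    simpa [mul_assoc] using ((hasDerivAt_id t).mul_const (b * v i)).const_add (v 2)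
  have hi' : HasDerivAt (fun s : ℂ => shearMap p i j (s * b) v i)
      (vectorAt D (shearMap p i j (t * b) v) i) t := by
    simp only [shearMap_left hij, hDi]
    exact hasDerivAt_const t _
  have h2' : HasDerivAt (fun s : ℂ => shearMap p i j (s * b) v 2)
      (vectorAt D (shearMap p i j (t * b) v) 2) t := by
    simp only [shearMap_two, hD2, shearMap_left hij]
    exact h2
  have hj' : HasDerivAt (fun s : ℂ => shearMap p i j (s * b) v j)
      (vectorAt D (shearMap p i j (t * b) v) j) t := by
    rw [hDj, shearMap_left hij, shearMap_two, ← hb]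
    by_cases h0 : v i = 0
    · -- on the line `u_i = 0` the motion is linear
      simp only [shearMap_right hij, h0, mul_zero, diffQuot_zero_right, add_zero]
      simpa [mul_assoc] using
        ((hasDerivAt_id t).mul_const (b * p.derivative.eval (v 2))).const_add (v j)
    · -- off that line, `u_j = p(z) / u_i`
      have hs (s : ℂ) : shearMap p i j (s * b) v j = p.eval (v 2 + s * b * v i) / v i := by
        have := hij.mul_eq_iff.1 (shearMap_mem_surface hij (s * b) P.2)
        rw [← hv, shearMap_left hij, shearMap_two] at this
        rw [eq_div_iff h0, mul_comm, this]
      simp only [hs]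
      refine (((p.hasDerivAt _).comp t h2).div_const (v i)).congr_deriv ?_
      field_simp
  refine hasDerivAt_pi.2 fun n => ?_
  rcases hij with ⟨rfl, rfl⟩ | ⟨rfl, rfl⟩ <;> fin_cases n <;> assumption

end Shear

section Flow

variable {ι : Type*} {p : Polynomial ℂ} {D : PolyVectorField} {φ ψ : ℂ → Equiv.Perm (surface p)}

/-- The coordinates of a tuple of points of the surface. -/
def coords (P : ι → surface p) : ι × Fin 3 → ℂ := fun n => (P n.1 : Fin 3 → ℂ) n.2

theorem eval_coords_rename (P : ι → surface p) (k : ι) (f : MvPolynomial (Fin 3) ℂ) :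
    eval (coords P) (rename (Prod.mk k) f) = eval (P k : Fin 3 → ℂ) f := by
  rw [eval_rename]
  rfl

theorem IsFlow.hasDerivAt_eval (h : IsFlow p D φ) (P : ι → surface p)
    (f : MvPolynomial (ι × Fin 3) ℂ) (t : ℂ) :
    HasDerivAt (fun s => eval (coords fun k => φ s (P k)) f)
      (eval (coords fun k => φ t (P k)) (diagonal ι D f)) t := by
  induction f using MvPolynomial.induction_on with
  | C a => simpa using hasDerivAt_const t a
  | add f g hf hg => simpa using! hf.add hg
  | mul_X f n hf =>
    have hX := hasDerivAt_pi.1 (h.hasDerivAt (P n.1) t) n.2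
    simp only [map_mul, eval_X, Derivation.leibniz, smul_eq_mul, map_add, diagonal_X,
      eval_coords_rename]
    refine (hf.mul hX).congr_deriv ?_
    simp only [vectorAt, coords]
    ring

theorem IsFlow.eval_zero (h : IsFlow p D φ) (P : ι → surface p) :
    (fun k => φ 0 (P k)) = P := by
  simp [h.map_zero]

/-- Along the flow of a locally nilpotent derivation every polynomial function is polynomial in the
time, and its Taylor coefficients are prescribed by the derivation. -/
theorem IsFlow.eq_of_isLocallyNilpotent (hD : IsLocallyNilpotent D) (hφ : IsFlow p D φ)
    (hψ : IsFlow p D ψ) : φ = ψ := by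
  have key (P : Unit → surface p) (n : ℕ) : ∀ f : MvPolynomial (Unit × Fin 3) ℂ,
      (diagonal Unit D)^[n] f = 0 → ∀ t : ℂ,
        eval (coords fun k => φ t (P k)) f = eval (coords fun k => ψ t (P k)) f := by
    induction n with
    | zero =>
      intro f hf t
      have hf : f = 0 := hf
      simp [hf]
    | succ n ih =>
      intro f hf t
      have hd (s : ℂ) := (hφ.hasDerivAt_eval P f s).sub (hψ.hasDerivAt_eval P f s)
      have := is_const_of_deriv_eq_zero (fun s => (hd s).differentiableAt)
        (fun s => by rw [(hd s).deriv, ih (diagonal Unit D f) hf s, sub_self]) t 0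
      simpa [hφ.eval_zero, hψ.eval_zero, sub_eq_zero] using this
  funext t
  ext1 Q
  refine Subtype.ext (funext fun c => ?_)
  obtain ⟨n, hn⟩ := exists_iterate_diagonal_eq_zero (ι := Unit) hD (X ((), c))
  simpa [coords] using key (fun _ => Q) n _ hn t

/-- The tuples of points of the surface at which all members of `K` vanish. -/
def zeroTuples (p : Polynomial ℂ) (K : Ideal (MvPolynomial (ι × Fin 3) ℂ)) :
    Set (ι → surface p) :=
  {P | ∀ f ∈ K, eval (coords P) f = 0}

/-- The zero set of an ideal is invariant under the flows of the locally nilpotent fields that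
preserve the ideal. -/
theorem IsFlow.mem_zeroTuples (hD : IsLocallyNilpotent D) (hφ : IsFlow p D φ)
    {K : Ideal (MvPolynomial (ι × Fin 3) ℂ)} (hK : D ∈ idealStabilizer K) {P : ι → surface p}
    (hP : P ∈ zeroTuples p K) (t : ℂ) : (fun k => φ t (P k)) ∈ zeroTuples p K := by
  have key (n : ℕ) : ∀ f ∈ K, (diagonal ι D)^[n] f = 0 → ∀ t : ℂ,
      eval (coords fun k => φ t (P k)) f = 0 := by
    induction n with
    | zero =>
      intro f _ hf t
      have hf : f = 0 := hf
      simp [hf]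
    | succ n ih =>
      intro f hfK hf t
      have hd (s : ℂ) := hφ.hasDerivAt_eval P f s
      have := is_const_of_deriv_eq_zero (fun s => (hd s).differentiableAt)
        (fun s => by rw [(hd s).deriv, ih (diagonal ι D f) (hK f hfK) hf s]) t 0
      rw [this, hφ.eval_zero]
      exact hP f hfK
  intro f hf
  obtain ⟨n, hn⟩ := exists_iterate_diagonal_eq_zero hD f
  exact key n f hf hn t

end Flow

section Group

variable {p : Polynomial ℂ}

theorem mem_generators_iff {D : PolyVectorField} :
    D ∈ generators p ↔ ∃ i j, IsPair i j ∧ ∃ q : Polynomial ℂ, (q = 1 ∨ q = Polynomial.X) ∧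
      D = Polynomial.aeval (X i : MvPolynomial (Fin 3) ℂ) q • shearField p i j := by
  constructor
  · rintro (rfl | rfl | rfl | rfl)
    · exact ⟨1, 0, .inr ⟨rfl, rfl⟩, 1, .inl rfl, by simp; rfl⟩
    · exact ⟨0, 1, .inl ⟨rfl, rfl⟩, 1, .inl rfl, by simp; rfl⟩
    · exact ⟨1, 0, .inr ⟨rfl, rfl⟩, .X, .inr rfl, by simp; rfl⟩
    · exact ⟨0, 1, .inl ⟨rfl, rfl⟩, .X, .inr rfl, by simp; rfl⟩
  · rintro ⟨i, j, ⟨rfl, rfl⟩ | ⟨rfl, rfl⟩, q, rfl | rfl, rfl⟩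
    · exact .inr (.inl (by simp; rfl))
    · exact .inr (.inr (.inr (by simp; rfl)))
    · exact .inl (by simp; rfl)
    · exact .inr (.inr (.inl (by simp; rfl)))

theorem shear_mem_flowGroup {i j : Fin 3} (hij : IsPair i j) {q : Polynomial ℂ}
    (hq : q = 1 ∨ q = Polynomial.X) (t : ℂ) :
    shear p hij (Polynomial.C t * q) ∈ flowGroup p :=
  Subgroup.subset_closure
    ⟨_, mem_generators_iff.2 ⟨i, j, hij, q, hq, rfl⟩, _, shear_isFlow hij q, t, rfl⟩

theorem IsPolynomialMap.comp {g h : surface p → surface p} (hg : IsPolynomialMap g)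
    (hh : IsPolynomialMap h) : IsPolynomialMap (g ∘ h) := by
  obtain ⟨F, hF⟩ := hg
  obtain ⟨E, hE⟩ := hh
  refine ⟨fun n => bind₁ E (F n), fun P n => ?_⟩
  have := aeval_bind₁ (R := ℂ) (P : Fin 3 → ℂ) E (F n)
  simp only [aeval_eq_eval] at this
  rw [Function.comp_apply, hF, this]
  congr 2
  funext k
  exact hE P k

theorem isAlgebraicAutomorphism_of_mem_flowGroup {g : Equiv.Perm (surface p)}
    (hg : g ∈ flowGroup p) : IsAlgebraicAutomorphism g := by
  induction hg using Subgroup.closure_induction with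
  | mem g hg =>
    obtain ⟨D, hD, φ, hφ, t, rfl⟩ := hg
    obtain ⟨i, j, hij, q, -, rfl⟩ := mem_generators_iff.1 hD
    rw [hφ.eq_of_isLocallyNilpotent (aeval_smul_shearField_isLocallyNilpotent hij q)
      (shear_isFlow hij q)]
    exact shear_isAlgebraicAutomorphism hij _
  | one => exact ⟨⟨X, fun P n => by simp⟩, ⟨X, fun P n => by simp; rfl⟩⟩
  | mul g h _ _ hg hh => exact ⟨hg.1.comp hh.1, hh.2.comp hg.2⟩
  | inv g _ hg => exact ⟨hg.2, hg.1⟩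

end Group

/-! ### Polynomial families in an orbit -/

section Family

variable {ι : Type*} {p : Polynomial ℂ} {N : ℕ}

/-- A tuple of points with coordinates in `ℂ[t_1, …, t_N]` all of whose specializations lie in the
orbit of the tuple `a` under the flow group. -/
def IsOrbitFamily (a : ι → surface p) (F : ι × Fin 3 → MvPolynomial (Fin N) ℂ) : Prop :=
  ∀ t : Fin N → ℂ, ∃ g ∈ flowGroup p, (fun n => eval t (F n)) = coords fun k => g (a k)

/-- The ideal of the polynomials vanishing identically on a family. -/
def familyIdeal (F : ι × Fin 3 → MvPolynomial (Fin N) ℂ) : Ideal (MvPolynomial (ι × Fin 3) ℂ) :=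
  RingHom.ker (bind₁ F)

instance (F : ι × Fin 3 → MvPolynomial (Fin N) ℂ) : (familyIdeal F).IsPrime :=
  RingHom.ker_isPrime _

theorem eval_bind₁_eq {σ τ : Type*} (F : σ → MvPolynomial τ ℂ) (t : τ → ℂ)
    (f : MvPolynomial σ ℂ) : eval t (bind₁ F f) = eval (fun n => eval t (F n)) f := by
  have := aeval_bind₁ (R := ℂ) t F f
  simpa only [aeval_eq_eval] using this

theorem mem_familyIdeal {F : ι × Fin 3 → MvPolynomial (Fin N) ℂ}
    {f : MvPolynomial (ι × Fin 3) ℂ} :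
    f ∈ familyIdeal F ↔ ∀ t : Fin N → ℂ, eval (fun n => eval t (F n)) f = 0 := by
  rw [familyIdeal, RingHom.mem_ker]
  simp only [← eval_bind₁_eq]
  exact ⟨fun h t => by rw [h, map_zero], fun h => funext fun t => by rw [h, map_zero]⟩

/-- The family obtained by shearing a family with a new parameter as the time. -/
def shearFamily (p : Polynomial ℂ) (i j : Fin 3) (q : Polynomial ℂ)
    (F : ι × Fin 3 → MvPolynomial (Fin N) ℂ) : ι × Fin 3 → MvPolynomial (Fin (N + 1)) ℂ :=
  fun n => shearMap p i j
    (X (Fin.last N) * Polynomial.aeval (rename Fin.castSucc (F (n.1, i))) q)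
    (fun c => rename Fin.castSucc (F (n.1, c))) n.2

theorem eval_shearFamily {i j : Fin 3} (hij : IsPair i j) (q : Polynomial ℂ)
    (F : ι × Fin 3 → MvPolynomial (Fin N) ℂ) (t : Fin N → ℂ) (s : ℂ) {P : ι → surface p}
    (hP : (fun n => eval t (F n)) = coords P) :
    (fun n => eval (Fin.snoc t s : Fin (N + 1) → ℂ) (shearFamily p i j q F n)) =
      coords fun k => shear p hij (Polynomial.C s * q) (P k) := by
  have hP' (k : ι) (c : Fin 3) : eval t (F (k, c)) = (P k : Fin 3 → ℂ) c := congrFun hP (k, c)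
  have ht : (Fin.snoc t s : Fin (N + 1) → ℂ) ∘ Fin.castSucc = t := by ext l; simp
  have hq (u : MvPolynomial (Fin (N + 1)) ℂ) (v : Fin (N + 1) → ℂ) :
      eval v (Polynomial.aeval u q) = q.eval (eval v u) := by
    have := Polynomial.aeval_algHom_apply (aeval v) u q
    simpa [aeval_eq_eval] using this.symm
  funext n
  rw [shearFamily, eval_shearMap, coords, coe_shear]
  simp [eval_rename, ht, hP', hq]

theorem IsOrbitFamily.shearFamily {a : ι → surface p} {F : ι × Fin 3 → MvPolynomial (Fin N) ℂ}
    (hF : IsOrbitFamily a F) {i j : Fin 3} (hij : IsPair i j) {q : Polynomial ℂ}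
    (hq : q = 1 ∨ q = Polynomial.X) : IsOrbitFamily a (shearFamily p i j q F) := by
  intro t
  obtain ⟨g, hg, h⟩ := hF (Fin.init t)
  refine ⟨_, mul_mem (shear_mem_flowGroup hij hq (t (Fin.last N))) hg, ?_⟩
  have := eval_shearFamily hij q F (Fin.init t) (t (Fin.last N)) h
  rwa [Fin.snoc_init_self] at this

/-- A family for which the vanishing ideal has minimal height cannot be enlarged by a further flow,
so its vanishing ideal is invariant under the generating fields. -/
theorem exists_isOrbitFamily_generators_subset [Finite ι] (a : ι → surface p) :
    ∃ (N : ℕ) (F : ι × Fin 3 → MvPolynomial (Fin N) ℂ), IsOrbitFamily a F ∧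
      ∀ D ∈ generators p, D ∈ idealStabilizer (familyIdeal F) := by
  let S : Set ℕ∞ := {h | ∃ (N : ℕ) (F : ι × Fin 3 → MvPolynomial (Fin N) ℂ),
    IsOrbitFamily a F ∧ (familyIdeal F).height = h}
  have hS : S.Nonempty := ⟨_, 0, fun n => C (coords a n), fun t => ⟨1, one_mem _, by simp⟩, rfl⟩
  obtain ⟨_, ⟨N, F, hF, rfl⟩, hmin⟩ := wellFounded_lt.has_min S hS
  refine ⟨N, F, hF, fun D hD => ?_⟩
  obtain ⟨i, j, hij, q, hq, rfl⟩ := mem_generators_iff.1 hD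
  have hle : familyIdeal (shearFamily p i j q F) ≤ familyIdeal F := by
    intro f hf
    rw [mem_familyIdeal] at hf ⊢
    intro t
    -- the parameter value `0` of the new shear gives back the old family
    obtain ⟨g, -, h⟩ := hF t
    have := hf (Fin.snoc t 0 : Fin (N + 1) → ℂ)
    rw [eval_shearFamily hij q F t 0 h] at this
    rw [h]
    simpa [shear_zero hij] using this
  have heq : familyIdeal (shearFamily p i j q F) = familyIdeal F := by
    refine hle.eq_of_not_lt fun hlt => ?_
    exact hmin _ ⟨_, _, hF.shearFamily hij hq, rfl⟩
      (Ideal.height_strict_mono_of_isPrime_of_isPrime hlt)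
  intro f hf
  rw [mem_familyIdeal]
  intro t
  obtain ⟨g, -, h⟩ := hF t
  have hd := (shear_isFlow (p := p) hij q).hasDerivAt_eval (fun k => g (a k)) f 0
  have hz (s : ℂ) : eval (coords fun k => shear p hij (Polynomial.C s * q) (g (a k))) f = 0 := by
    rw [← heq, mem_familyIdeal] at hf
    have := hf (Fin.snoc t s : Fin (N + 1) → ℂ)
    rwa [eval_shearFamily hij q F t s h] at this
  simp only [hz] at hd
  rw [(shear_isFlow (p := p) hij q).eval_zero] at hd
  rw [h]
  exact hd.unique (hasDerivAt_const _ _)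

theorem IsOrbitFamily.exists_eval_ne_zero {a : ι → surface p}
    {F : ι × Fin 3 → MvPolynomial (Fin N) ℂ} (hF : IsOrbitFamily a F)
    {f : MvPolynomial (ι × Fin 3) ℂ} (hf : f ∉ familyIdeal F) :
    ∃ g ∈ flowGroup p, (fun k => g (a k)) ∈ zeroTuples p (familyIdeal F) ∧
      eval (coords fun k => g (a k)) f ≠ 0 := by
  rw [mem_familyIdeal] at hf
  push Not at hf
  obtain ⟨t, ht⟩ := hf
  obtain ⟨g, hg, h⟩ := hF t
  refine ⟨g, hg, fun e he => ?_, h ▸ ht⟩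
  rw [← h]
  exact mem_familyIdeal.1 he t

end Family

/-! ### Zariski density of the orbits -/

section Moves

variable {p : Polynomial ℂ} {i j : Fin 3}

theorem exists_eval_eq (hp : p.natDegree ≠ 0) (c : ℂ) : ∃ w, p.eval w = c := by
  obtain ⟨w, hw⟩ := IsAlgClosed.exists_root (p - Polynomial.C c) (by
    rw [Polynomial.degree_sub_C (Polynomial.natDegree_pos_iff_degree_pos.1 (by omega))]
    exact fun h => hp (Polynomial.natDegree_eq_of_degree_eq_some h))
  exact ⟨w, by simpa [sub_eq_zero] using hw⟩

/-- A nonconstant polynomial has no periods. -/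
theorem eq_zero_of_eval_add_eq (hp : p.natDegree ≠ 0) {δ : ℂ}
    (h : ∀ u, p.eval (u + δ) = p.eval u) : δ = 0 := by
  by_contra hδ
  have hn (n : ℕ) : p.eval (n * δ) = p.eval 0 := by
    induction n with
    | zero => simp
    | succ n ih => rw [← ih, ← h (n * δ)]; push_cast; ring_nf
  have : p = Polynomial.C (p.eval 0) := by
    refine Polynomial.eq_of_infinite_eval_eq _ _
      ((Set.infinite_range_of_injective (f := fun n : ℕ => (n : ℂ) * δ) fun a b hab => ?_).mono ?_)
    · exact Nat.cast_injective (mul_right_cancel₀ hδ hab)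
    · rintro _ ⟨n, rfl⟩
      simp [hn]
  rw [this] at hp
  simp at hp

theorem shear_apply_left (hij : IsPair i j) (q : Polynomial ℂ) (P : surface p) :
    (shear p hij q P : Fin 3 → ℂ) i = (P : Fin 3 → ℂ) i := by
  rw [coe_shear, shearMap_left hij]

theorem shear_apply_two (hij : IsPair i j) (q : Polynomial ℂ) (P : surface p) :
    (shear p hij q P : Fin 3 → ℂ) 2 =
      (P : Fin 3 → ℂ) 2 + q.eval ((P : Fin 3 → ℂ) i) * (P : Fin 3 → ℂ) i := by
  rw [coe_shear, shearMap_two]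

theorem mul_shear_apply_right (hij : IsPair i j) (q : Polynomial ℂ) (P : surface p) :
    (P : Fin 3 → ℂ) i * (shear p hij q P : Fin 3 → ℂ) j =
      p.eval ((P : Fin 3 → ℂ) 2 + q.eval ((P : Fin 3 → ℂ) i) * (P : Fin 3 → ℂ) i) := by
  rw [← shear_apply_left hij q P, hij.mul_eq_iff.1 (shear p hij q P).2, shear_apply_two,
    shear_apply_left hij q P]

/-- A shear moves any given point off the curve `u_j = 0`; where that curve meets `u_i = 0`, this
uses that the zeros of `p` are simple. -/
theorem exists_shear_apply_ne_zero (hij : IsPair i j) (hp : p.natDegree ≠ 0)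
    (hsimple : ∀ z : ℂ, p.eval z = 0 → p.derivative.eval z ≠ 0) (P : surface p)
    (hP : (P : Fin 3 → ℂ) j = 0) : ∃ c, (shear p hij (Polynomial.C c) P : Fin 3 → ℂ) j ≠ 0 := by
  have hz : p.eval ((P : Fin 3 → ℂ) 2) = 0 := by
    rw [← hij.mul_eq_iff.1 P.2, hP, mul_zero]
  by_cases hi : (P : Fin 3 → ℂ) i = 0
  · refine ⟨1, ?_⟩
    rw [coe_shear, shearMap_right hij, hi, mul_zero, diffQuot_zero_right, hP]
    simpa using hsimple _ hz
  · obtain ⟨w, hw⟩ := exists_eval_eq hp 1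
    refine ⟨(w - (P : Fin 3 → ℂ) 2) / (P : Fin 3 → ℂ) i, fun h => ?_⟩
    have := mul_shear_apply_right hij
      (Polynomial.C ((w - (P : Fin 3 → ℂ) 2) / (P : Fin 3 → ℂ) i)) P
    rw [h, Polynomial.eval_C, div_mul_cancel₀ _ hi, add_sub_cancel, hw, mul_zero] at this
    exact zero_ne_one this

/-- Two points off the curve `u_i = 0` can be given different coordinates `u_j`. -/
theorem exists_shear_apply_ne (hij : IsPair i j) (hp : p.natDegree ≠ 0) {P Q : surface p}
    (hPQ : P ≠ Q) (hP : (P : Fin 3 → ℂ) i ≠ 0) (hQ : (Q : Fin 3 → ℂ) i ≠ 0) :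
    ∃ s s' : ℂ,
      (shear p hij (Polynomial.C s + Polynomial.C s' * Polynomial.X) P : Fin 3 → ℂ) j ≠
        (shear p hij (Polynomial.C s + Polynomial.C s' * Polynomial.X) Q : Fin 3 → ℂ) j := by
  by_cases h : (P : Fin 3 → ℂ) i = (Q : Fin 3 → ℂ) i
  · by_contra! hc
    have hδ : (P : Fin 3 → ℂ) 2 - (Q : Fin 3 → ℂ) 2 = 0 := by
      refine eq_zero_of_eval_add_eq hp fun u => ?_
      set s := (u - (Q : Fin 3 → ℂ) 2) / (P : Fin 3 → ℂ) i with hs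
      have hs' : s * (P : Fin 3 → ℂ) i = u - (Q : Fin 3 → ℂ) 2 := div_mul_cancel₀ _ hP
      have h₁ := mul_shear_apply_right hij (Polynomial.C s + Polynomial.C 0 * Polynomial.X) P
      have h₂ := mul_shear_apply_right hij (Polynomial.C s + Polynomial.C 0 * Polynomial.X) Q
      rw [hc s 0, h, h₂, ← h] at h₁
      simp only [Polynomial.eval_add, Polynomial.eval_mul, Polynomial.eval_C, zero_mul, add_zero,
        hs'] at h₁
      convert h₁.symm using 2 <;> ring
    refine hPQ (Subtype.ext (hij.ext h ?_ (sub_eq_zero.1 hδ)))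
    have h₁ := hij.mul_eq_iff.1 P.2
    rw [sub_eq_zero.1 hδ, ← hij.mul_eq_iff.1 Q.2, h] at h₁
    exact mul_left_cancel₀ hQ h₁
  · -- the parameter function is chosen to vanish at `Q`, which therefore stays fixed
    obtain ⟨w, hw⟩ := exists_eval_eq hp ((P : Fin 3 → ℂ) i * ((Q : Fin 3 → ℂ) j + 1))
    have hx : (P : Fin 3 → ℂ) i - (Q : Fin 3 → ℂ) i ≠ 0 := sub_ne_zero.2 h
    set s' := (w - (P : Fin 3 → ℂ) 2) / (P : Fin 3 → ℂ) i /
      ((P : Fin 3 → ℂ) i - (Q : Fin 3 → ℂ) i) with hs'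
    refine ⟨-(s' * (Q : Fin 3 → ℂ) i), s', fun hc => ?_⟩
    have h₁ := mul_shear_apply_right hij
      (Polynomial.C (-(s' * (Q : Fin 3 → ℂ) i)) + Polynomial.C s' * Polynomial.X) P
    have h₂ : (shear p hij (Polynomial.C (-(s' * (Q : Fin 3 → ℂ) i)) +
        Polynomial.C s' * Polynomial.X) Q : Fin 3 → ℂ) j = (Q : Fin 3 → ℂ) j := by
      rw [coe_shear]
      simp [shearMap_zero hij]
    have h₃ : (P : Fin 3 → ℂ) 2 + (-(s' * (Q : Fin 3 → ℂ) i) + s' * (P : Fin 3 → ℂ) i) *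
        (P : Fin 3 → ℂ) i = w := by
      rw [hs']; field_simp; ring
    rw [hc, h₂] at h₁
    simp only [Polynomial.eval_add, Polynomial.eval_mul, Polynomial.eval_C, Polynomial.eval_X,
      h₃, hw] at h₁
    have := mul_left_cancel₀ hP h₁
    simp at this

end Moves

section Density

variable {ι : Type*} {p : Polynomial ℂ} {i j : Fin 3} {K : Ideal (MvPolynomial (ι × Fin 3) ℂ)}

theorem shear_mem_zeroTuples (hij : IsPair i j) {q : Polynomial ℂ}
    (hq : Polynomial.aeval (X i : MvPolynomial (Fin 3) ℂ) q • shearField p i j ∈ idealStabilizer K)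
    {P : ι → surface p} (hP : P ∈ zeroTuples p K) :
    (fun k => shear p hij q (P k)) ∈ zeroTuples p K := by
  simpa using (shear_isFlow hij q).mem_zeroTuples
    (aeval_smul_shearField_isLocallyNilpotent hij q) hq hP 1

theorem affine_smul_shearField_mem (hij : IsPair i j)
    (hK : ∀ D ∈ generators p, D ∈ idealStabilizer K) (s s' : ℂ) :
    Polynomial.aeval (X i : MvPolynomial (Fin 3) ℂ)
      (Polynomial.C s + Polynomial.C s' * Polynomial.X) • shearField p i j ∈
        idealStabilizer K := by
  have h₁ := hK _ (mem_generators_iff.2 ⟨i, j, hij, 1, .inl rfl, rfl⟩)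
  have h₂ := hK _ (mem_generators_iff.2 ⟨i, j, hij, .X, .inr rfl, rfl⟩)
  convert add_mem ((idealStabilizer K).smul_mem s h₁) ((idealStabilizer K).smul_mem s' h₂) using 1
  refine derivation_ext fun n => ?_
  simp [smul_eq_C_mul]
  ring

theorem X_notMem (hij : IsPair i j) (hp : p.natDegree ≠ 0)
    (hsimple : ∀ z : ℂ, p.eval z = 0 → p.derivative.eval z ≠ 0)
    (hK : ∀ D ∈ generators p, D ∈ idealStabilizer K) (hne : (zeroTuples p K).Nonempty) (k : ι) :
    X (k, j) ∉ K := by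
  intro h
  have h0 {P : ι → surface p} (hP : P ∈ zeroTuples p K) : (P k : Fin 3 → ℂ) j = 0 := by
    simpa [coords] using hP _ h
  obtain ⟨P, hP⟩ := hne
  obtain ⟨c, hc⟩ := exists_shear_apply_ne_zero hij hp hsimple (P k) (h0 hP)
  have := affine_smul_shearField_mem hij hK c 0
  rw [Polynomial.C_0, zero_mul, add_zero] at this
  exact hc (h0 (shear_mem_zeroTuples hij this hP))

theorem X_sub_X_notMem (hij : IsPair i j) (hp : p.natDegree ≠ 0)
    (hK : ∀ D ∈ generators p, D ∈ idealStabilizer K) {k l : ι}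
    (hne : ∃ P ∈ zeroTuples p K, P k ≠ P l ∧ (P k : Fin 3 → ℂ) i ≠ 0 ∧ (P l : Fin 3 → ℂ) i ≠ 0) :
    X (k, j) - X (l, j) ∉ K := by
  intro h
  have h0 {P : ι → surface p} (hP : P ∈ zeroTuples p K) :
      (P k : Fin 3 → ℂ) j = (P l : Fin 3 → ℂ) j := by
    simpa [coords, sub_eq_zero] using hP _ h
  obtain ⟨P, hP, hkl, hk, hl⟩ := hne
  obtain ⟨s, s', hs⟩ := exists_shear_apply_ne hij hp hkl hk hl
  exact hs (h0 (shear_mem_zeroTuples hij (affine_smul_shearField_mem hij hK s s') hP))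

variable [Fintype ι]

/-- Interpolation: since the Lie algebra contains `u_i ^ d * r(u_i)` times the shear field for every
polynomial `r`, the coordinates `z` of all points can be prescribed. -/
theorem exists_mem_zeroTuples_apply_two_eq (hij : IsPair i j) (hp : 2 ≤ p.natDegree)
    (hK : ∀ D ∈ generators p, D ∈ idealStabilizer K) {P : ι → surface p}
    (hP : P ∈ zeroTuples p K) (hinj : Function.Injective fun k => (P k : Fin 3 → ℂ) i)
    (h0 : ∀ k, (P k : Fin 3 → ℂ) i ≠ 0) (ζ : ι → ℂ) :
    ∃ Q ∈ zeroTuples p K, (∀ k, (Q k : Fin 3 → ℂ) i = (P k : Fin 3 → ℂ) i) ∧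
      ∀ k, (Q k : Fin 3 → ℂ) 2 = ζ k := by
  classical
  set r := Lagrange.interpolate Finset.univ (fun k => (P k : Fin 3 → ℂ) i)
    (fun k => (ζ k - (P k : Fin 3 → ℂ) 2) / (P k : Fin 3 → ℂ) i ^ (p.natDegree + 1)) with hr
  have h₁ := hK _ (mem_generators_iff.2 ⟨i, j, hij, 1, .inl rfl, rfl⟩)
  have h₂ := hK _ (mem_generators_iff.2 ⟨i, j, hij, .X, .inr rfl, rfl⟩)
  have h₃ := hK _ (mem_generators_iff.2 ⟨j, i, hij.symm, 1, .inl rfl, rfl⟩)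
  rw [map_one, one_smul] at h₁ h₃
  rw [Polynomial.aeval_X] at h₂
  refine ⟨_, shear_mem_zeroTuples hij (aeval_smul_shearField_mem hij hp h₁ h₂ h₃ r) hP,
    fun k => shear_apply_left hij _ _, fun k => ?_⟩
  rw [shear_apply_two, Polynomial.eval_mul, hr,
    Lagrange.eval_interpolate_at_node (v := fun k => (P k : Fin 3 → ℂ) i) _ hinj.injOn
      (Finset.mem_univ k)]
  have := h0 k
  simp only [Polynomial.eval_pow, Polynomial.eval_X]
  field_simp
  ring

/-- The zero set of an invariant ideal contains, as soon as it contains one tuple with distinct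
nonzero coordinates `u_j`, points over all such tuples of coordinates `u_j` and all `z`. -/
theorem exists_mem_zeroTuples (hij : IsPair i j) (hp : 2 ≤ p.natDegree)
    (hK : ∀ D ∈ generators p, D ∈ idealStabilizer K) {P : ι → surface p}
    (hP : P ∈ zeroTuples p K) (hinj : Function.Injective fun k => (P k : Fin 3 → ℂ) j)
    (h0 : ∀ k, (P k : Fin 3 → ℂ) j ≠ 0) {η : ι → ℂ} (hη : Function.Injective η)
    (hη0 : ∀ k, η k ≠ 0) (ζ : ι → ℂ) :
    ∃ Q ∈ zeroTuples p K, (∀ k, (Q k : Fin 3 → ℂ) j = η k) ∧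
      ∀ k, (Q k : Fin 3 → ℂ) 2 = ζ k := by
  have hp' : p.natDegree ≠ 0 := by omega
  -- the intermediate values of `u_i` only have to be distinct and nonzero
  obtain ⟨ξ, hξ, hξ0⟩ : ∃ ξ : ι → ℂ, Function.Injective ξ ∧ ∀ k, ξ k ≠ 0 := by
    exact ⟨fun k => ((Fintype.equivFin ι k : ℕ) : ℂ) + 1, fun k l h =>
      (Fintype.equivFin ι).injective (Fin.ext (by simpa using h)), fun k =>
        Nat.cast_add_one_ne_zero _⟩
  choose z₁ hz₁ using fun k => exists_eval_eq hp' (ξ k * (P k : Fin 3 → ℂ) j)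
  choose z₂ hz₂ using fun k => exists_eval_eq hp' (ξ k * η k)
  obtain ⟨Q₁, hQ₁, hj₁, h2₁⟩ :=
    exists_mem_zeroTuples_apply_two_eq hij.symm hp hK hP hinj h0 z₁
  have hi₁ (k : ι) : (Q₁ k : Fin 3 → ℂ) i = ξ k := by
    have := hij.mul_eq_iff.1 (Q₁ k).2
    rw [h2₁, hz₁, hj₁] at this
    exact mul_right_cancel₀ (h0 k) this
  obtain ⟨Q₂, hQ₂, hi₂, h2₂⟩ := exists_mem_zeroTuples_apply_two_eq hij hp hK hQ₁
    (by simpa only [hi₁] using hξ) (by simpa only [hi₁] using hξ0) z₂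
  have hj₂ (k : ι) : (Q₂ k : Fin 3 → ℂ) j = η k := by
    have := hij.mul_eq_iff.1 (Q₂ k).2
    rw [h2₂, hz₂, hi₂, hi₁] at this
    exact mul_left_cancel₀ (hξ0 k) this
  obtain ⟨Q₃, hQ₃, hj₃, h2₃⟩ := exists_mem_zeroTuples_apply_two_eq hij.symm hp hK hQ₂
    (by simpa only [hj₂] using hη) (by simpa only [hj₂] using hη0) ζ
  exact ⟨Q₃, hQ₃, fun k => (hj₃ k).trans (hj₂ k), h2₃⟩

end Density

/-! ### Images of dominant polynomial maps -/

/-- A dominant polynomial map `ℂ^τ → ℂ^σ` has all points outside a hypersurface in its image. By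
Chevalley's theorem the range on spectra is constructible; it contains the generic point, hence a
basic open set, and closed points of that set lift to closed points by the Nullstellensatz. -/
theorem exists_ne_zero_forall_eval_ne_zero_mem_range {σ τ : Type*} [Finite σ] [Finite τ]
    (G : σ → MvPolynomial τ ℂ) (hG : Function.Injective (bind₁ G)) :
    ∃ h : MvPolynomial σ ℂ, h ≠ 0 ∧
      ∀ u : σ → ℂ, eval u h ≠ 0 → ∃ t : τ → ℂ, ∀ n, eval t (G n) = u n := by
  set ψ : MvPolynomial σ ℂ →+* MvPolynomial τ ℂ := (bind₁ G).toRingHom with hψ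
  have hψinj : Function.Injective ψ := hG
  have hfin : ψ.FinitePresentation := by
    refine RingHom.FinitePresentation.of_finiteType.1 ?_
    have h₁ : (ψ.comp (C : ℂ →+* MvPolynomial σ ℂ)).FiniteType := by
      have : ψ.comp (C : ℂ →+* MvPolynomial σ ℂ) = algebraMap ℂ (MvPolynomial τ ℂ) :=
        RingHom.ext fun c => by simp [hψ, algebraMap_eq]
      rw [this, RingHom.finiteType_algebraMap]
      infer_instance
    exact h₁.of_comp_finiteType
  obtain ⟨S, hS⟩ := PrimeSpectrum.exists_constructibleSetData_iff.2
    (PrimeSpectrum.isConstructible_range_comap hfin)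
  have hbot : (⟨⊥, Ideal.isPrime_bot⟩ : PrimeSpectrum (MvPolynomial σ ℂ)) ∈
      Set.range (PrimeSpectrum.comap ψ) := by
    refine ⟨⟨⊥, Ideal.isPrime_bot⟩, PrimeSpectrum.ext ?_⟩
    exact (RingHom.injective_iff_ker_eq_bot ψ).1 hψinj
  rw [← hS] at hbot
  simp only [PrimeSpectrum.ConstructibleSetData.toSet, Set.mem_iUnion] at hbot
  obtain ⟨c, hc, hbot⟩ := hbot
  have hg : Set.range c.g ⊆ {0} := by
    have := hbot.1
    rw [PrimeSpectrum.mem_zeroLocus] at this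
    intro x hx
    exact this hx
  have hf : c.f ≠ 0 := by
    intro h
    apply hbot.2
    simp [h]
  refine ⟨c.f, hf, fun u hu => ?_⟩
  -- the maximal ideal of the point `u`
  have hmax : (RingHom.ker (eval u)).IsMaximal :=
    RingHom.ker_isMaximal_of_surjective _ fun z => ⟨C z, eval_C z⟩
  have hmem : (⟨RingHom.ker (eval u), hmax.isPrime⟩ : PrimeSpectrum (MvPolynomial σ ℂ)) ∈
      Set.range (PrimeSpectrum.comap ψ) := by
    rw [← hS]
    simp only [PrimeSpectrum.ConstructibleSetData.toSet, Set.mem_iUnion]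
    refine ⟨c, hc, ?_, fun h => ?_⟩
    · rw [PrimeSpectrum.mem_zeroLocus]
      intro x hx
      rw [Set.mem_singleton_iff.1 (hg hx)]
      exact zero_mem _
    · rw [PrimeSpectrum.mem_zeroLocus] at h
      exact hu (RingHom.mem_ker.1 (h rfl))
  obtain ⟨Q, hQ⟩ := hmem
  obtain ⟨M, hM, hQM⟩ := Ideal.exists_le_maximal Q.asIdeal Q.isPrime.ne_top
  obtain ⟨t, ht⟩ := eq_vanishingIdeal_singleton_of_isMaximal ℂ hM
  refine ⟨t, fun n => ?_⟩
  have h₁ : X n - C (u n) ∈ RingHom.ker (eval u) := by simp [RingHom.mem_ker]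
  have h₂ : ψ (X n - C (u n)) ∈ Q.asIdeal := by
    have := congrArg PrimeSpectrum.asIdeal hQ
    simp only [PrimeSpectrum.comap_asIdeal] at this
    rw [← this] at h₁
    exact h₁
  have h₃ := hQM h₂
  rw [ht, mem_vanishingIdeal_singleton_iff] at h₃
  simpa [hψ, aeval_eq_eval, sub_eq_zero] using h₃

/-! ### Infinite transitivity -/

section Transitivity

variable {ι : Type*} [Fintype ι] {p : Polynomial ℂ}

open Classical in
/-- The polynomial that is nonzero exactly at the tuples whose `c`-th coordinates are distinct and
nonzero. -/
def genericity {κ : Type*} (ι : Type*) [Fintype ι] (c : κ) : MvPolynomial (ι × κ) ℂ :=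
  (∏ k : ι, X (k, c)) *
    ∏ k : ι, ∏ l ∈ (Finset.univ : Finset ι).erase k, (X (k, c) - X (l, c))

theorem eval_genericity_ne_zero_iff {κ : Type*} {c : κ} {u : ι × κ → ℂ} :
    eval u (genericity ι c) ≠ 0 ↔
      (Function.Injective fun k => u (k, c)) ∧ ∀ k, u (k, c) ≠ 0 := by
  classical
  simp only [genericity, map_mul, map_prod, eval_X, map_sub, mul_ne_zero_iff,
    Finset.prod_ne_zero_iff, Finset.mem_univ, Finset.mem_erase, true_implies, sub_ne_zero, and_true]
  rw [and_comm]
  refine and_congr_left fun _ => ⟨fun h k l hkl => ?_, fun h k l hlk hkl => hlk (h hkl).symm⟩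
  by_contra hne
  exact h k l (Ne.symm hne) hkl

theorem genericity_ne_zero {κ : Type*} (c : κ) : genericity ι c ≠ 0 := by
  classical
  refine mul_ne_zero (Finset.prod_ne_zero_iff.2 fun k _ => X_ne_zero _)
    (Finset.prod_ne_zero_iff.2 fun k _ => Finset.prod_ne_zero_iff.2 fun l hl => ?_)
  rw [sub_ne_zero]
  intro h
  exact (Finset.ne_of_mem_erase hl) (by simpa using (X_injective h).symm)

/-- The orbit of a tuple of distinct points covers, in the coordinates `(y, z)`, the complement of
a hypersurface. -/
theorem exists_ne_zero_forall_exists_mem_flowGroup (hp : 2 ≤ p.natDegree)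
    (hsimple : ∀ z : ℂ, p.eval z = 0 → p.derivative.eval z ≠ 0) {a : ι → surface p}
    (ha : Function.Injective a) :
    ∃ h : MvPolynomial (ι × Fin 2) ℂ, h ≠ 0 ∧ ∀ u : ι × Fin 2 → ℂ, eval u h ≠ 0 →
      ∃ g ∈ flowGroup p, ∀ n : ι × Fin 2, (g (a n.1) : Fin 3 → ℂ) n.2.succ = u n := by
  classical
  have hp' : p.natDegree ≠ 0 := by omega
  obtain ⟨N, F, hF, hK⟩ := exists_isOrbitFamily_generators_subset a
  have hpair : IsPair 0 1 := .inl ⟨rfl, rfl⟩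
  have hprime : (familyIdeal F).IsPrime := inferInstance
  have hne : (zeroTuples p (familyIdeal F)).Nonempty := by
    obtain ⟨g, -, hg, -⟩ := hF.exists_eval_ne_zero (f := 1)
      ((Ideal.ne_top_iff_one _).1 hprime.ne_top)
    exact ⟨_, hg⟩
  -- some tuple of the family lies off the curve `x = 0`
  obtain ⟨g₁, -, hg₁, hx⟩ := hF.exists_eval_ne_zero (f := ∏ k : ι, X (k, 0)) (by
    rw [hprime.prod_mem_iff]
    push Not
    exact fun k _ => X_notMem hpair.symm hp' hsimple hK hne k)
  have hx (k : ι) : (g₁ (a k) : Fin 3 → ℂ) 0 ≠ 0 := by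
    simp only [map_prod, eval_X, Finset.prod_ne_zero_iff] at hx
    exact hx k (Finset.mem_univ k)
  -- and therefore some tuple of the family has distinct nonzero coordinates `y`
  obtain ⟨g₂, -, hg₂, hy⟩ := hF.exists_eval_ne_zero (f := genericity ι 1) (by
    rw [genericity, hprime.mul_mem_iff_mem_or_mem, hprime.prod_mem_iff,
      hprime.prod_mem_iff]
    simp only [hprime.prod_mem_iff]
    push Not
    refine ⟨fun k _ => X_notMem hpair hp' hsimple hK hne k, fun k _ l hl => ?_⟩
    refine X_sub_X_notMem hpair hp' hK ⟨_, hg₁, fun h => ?_, hx k, hx l⟩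
    exact Finset.ne_of_mem_erase hl (ha (g₁.injective h)).symm)
  obtain ⟨hinj, h0⟩ := eval_genericity_ne_zero_iff.1 hy
  set e : ι × Fin 2 → ι × Fin 3 := fun n => (n.1, n.2.succ) with he
  have hG : Function.Injective (bind₁ fun n => F (e n)) := by
    refine (injective_iff_map_eq_zero _).2 fun f hf => ?_
    have hfK : rename e f ∈ familyIdeal F := by
      rw [familyIdeal, RingHom.mem_ker]
      rw [bind₁_rename]
      exact hf
    refine (mul_eq_zero.1 (?_ : f * genericity ι 0 = 0)).resolve_right (genericity_ne_zero _)
    refine funext fun u => ?_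
    rw [map_zero, map_mul]
    by_cases hu : eval u (genericity ι 0) = 0
    · rw [hu, mul_zero]
    obtain ⟨hη, hη0⟩ := eval_genericity_ne_zero_iff.1 hu
    obtain ⟨Q, hQ, hQ1, hQ2⟩ := exists_mem_zeroTuples hpair hp hK hg₂ hinj h0 hη hη0
      fun k => u (k, 1)
    have := hQ _ hfK
    rw [eval_rename] at this
    have hcoords : coords Q ∘ e = u := by
      funext n
      obtain ⟨k, c⟩ := n
      fin_cases c
      exacts [hQ1 k, hQ2 k]
    rw [← hcoords, this, zero_mul]
  obtain ⟨h, hh, hrange⟩ := exists_ne_zero_forall_eval_ne_zero_mem_range _ hG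
  refine ⟨h, hh, fun u hu => ?_⟩
  obtain ⟨t, ht⟩ := hrange u hu
  obtain ⟨g, hg, hgt⟩ := hF t
  exact ⟨g, hg, fun n => (congrFun hgt (e n)).symm.trans (ht n)⟩

theorem exists_mem_flowGroup_apply_eq (hp : 2 ≤ p.natDegree)
    (hsimple : ∀ z : ℂ, p.eval z = 0 → p.derivative.eval z ≠ 0) {a b : ι → surface p}
    (ha : Function.Injective a) (hb : Function.Injective b) :
    ∃ g ∈ flowGroup p, ∀ k, g (a k) = b k := by
  obtain ⟨h₁, hh₁, H₁⟩ := exists_ne_zero_forall_exists_mem_flowGroup hp hsimple ha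
  obtain ⟨h₂, hh₂, H₂⟩ := exists_ne_zero_forall_exists_mem_flowGroup hp hsimple hb
  obtain ⟨u, hu⟩ : ∃ u, eval u (h₁ * h₂ * genericity ι 0) ≠ 0 := by
    by_contra! hu
    exact mul_ne_zero (mul_ne_zero hh₁ hh₂) (genericity_ne_zero _)
      (funext fun u => by rw [hu, map_zero])
  simp only [map_mul, mul_ne_zero_iff] at hu
  obtain ⟨⟨hu₁, hu₂⟩, hu⟩ := hu
  obtain ⟨g₁, hg₁, e₁⟩ := H₁ u hu₁
  obtain ⟨g₂, hg₂, e₂⟩ := H₂ u hu₂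
  have h0 := (eval_genericity_ne_zero_iff.1 hu).2
  -- a point with `y ≠ 0` is determined by `(y, z)`, so the two orbits meet over `u`
  have key (k : ι) : g₁ (a k) = g₂ (b k) := by
    have hy : (g₁ (a k) : Fin 3 → ℂ) 1 = (g₂ (b k) : Fin 3 → ℂ) 1 :=
      (e₁ (k, 0)).trans (e₂ (k, 0)).symm
    have hz : (g₁ (a k) : Fin 3 → ℂ) 2 = (g₂ (b k) : Fin 3 → ℂ) 2 :=
      (e₁ (k, 1)).trans (e₂ (k, 1)).symm
    have hpair : IsPair 0 1 := .inl ⟨rfl, rfl⟩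
    refine Subtype.ext (hpair.ext ?_ hy hz)
    have h := hpair.mul_eq_iff.1 (g₁ (a k)).2
    have h' := hpair.mul_eq_iff.1 (g₂ (b k)).2
    rw [hz, ← h', hy] at h
    refine mul_right_cancel₀ ?_ h
    rw [← hy]
    exact (e₁ (k, 0)).symm ▸ h0 k
  refine ⟨g₂⁻¹ * g₁, mul_mem (inv_mem hg₂) hg₁, fun k => ?_⟩
  rw [Equiv.Perm.mul_apply, key]
  exact g₂.symm_apply_apply (b k)

end Transitivity

theorem flowGroup_actsInfinitelyTransitively {p : Polynomial ℂ} (hp : 2 ≤ p.natDegree)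
    (hsimple : ∀ z : ℂ, p.eval z = 0 → p.derivative.eval z ≠ 0) :
    ActsInfinitelyTransitively (flowGroup p) := by
  refine ⟨fun g hg => isAlgebraicAutomorphism_of_mem_flowGroup hg, fun m => ⟨fun a b => ?_⟩⟩
  obtain ⟨g, hg, h⟩ := exists_mem_flowGroup_apply_eq hp hsimple a.injective b.injective
  exact ⟨⟨g, hg⟩, DFunLike.ext _ _ h⟩

end Danielewski
end

theorem mainTheorem3 (p : Polynomial ℂ) (hdeg : 2 ≤ p.natDegree)
    (hsimple : ∀ z : ℂ, p.eval z = 0 → p.derivative.eval z ≠ 0) :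
    (∀ D ∈ Danielewski.generators p,
      Danielewski.IsLocallyNilpotent D ∧
      D (Danielewski.equation p) = 0 ∧
      ∃! φ : ℂ → Equiv.Perm (Danielewski.surface p), Danielewski.IsFlow p D φ) ∧
    Danielewski.ActsInfinitelyTransitively (Danielewski.flowGroup p) := by
  refine ⟨fun D hD => ?_, Danielewski.flowGroup_actsInfinitelyTransitively hdeg hsimple⟩
  obtain ⟨i, j, hij, q, -, rfl⟩ := Danielewski.mem_generators_iff.1 hD
  have hnil := Danielewski.aeval_smul_shearField_isLocallyNilpotent (p := p) hij q
  exact ⟨hnil, Danielewski.aeval_smul_shearField_equation hij q, _,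
    Danielewski.shear_isFlow hij q,
    fun φ hφ => hφ.eq_of_isLocallyNilpotent hnil (Danielewski.shear_isFlow hij q)⟩
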